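/- Let $L$ be a spacetime of dimension $n$, that is, a smooth (Hausdorff, second countable) $n$-manifold with a smooth Lorentzian metric $\langle\cdot,\cdot\rangle$ of signature $(-,+,\dots,+)$ and a time orientation. Curves are piecewise smooth, a causal curve $c:[a,b]\to L$ has length $\int_a^b\sqrt{-\langle c',c'\rangle}\,dt$, $d(p,q)\in[0,\infty]$ is the supremum of the lengths of the future-directed causal curves from $p$ to $q$ (and $0$ if there are none), and $d_N(q)=\sup_{p\in N}d(p,q)$ for $N\subset L$. For an embedded submanifold $N$ of $L$ (without boundary), and a future-directed unit timelike vector $\nu$ normal to $N$ at $p\in N$, let $\gamma_\nu$ be the inextensible geodesic with $\gamma_\nu(0)=p$, $\gamma_\nu'(0)=\nu$, and let $s_N(\nu)=\sup\{t\ge 0: d_N(\gamma_\nu(t))=t\}\in[0,\infty]$. Let $\tilde{\mathcal I}^+(N)$ be the set of all vectors $t\nu$ with such $\nu$ and $0<t<s_N(\nu)$, and let $\mathcal I^+(N)=\exp_N(\mathrm{int}\,\tilde{\mathcal I}^+(N))$, where $\exp_N$ is the exponential map of $L$ restricted to the normal bundle of $N$ and the interior is taken in that normal bundle. (If $N$ is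 a spacelike hypersurface, $\nu$ is its future unit normal field.) Let $N$ and $\Sigma$ be embedded submanifolds of $L$ (without boundary, of any dimensions) such that $\Sigma\subset\mathcal I^+(N)$. Let $l>0$ and let $\gamma:[0,l]\to L$ be a future-directed timelike geodesic with $\gamma(0)\in N$ and $\gamma(l)\in\Sigma$ which is the longest curve from $N$ to $\Sigma$: every future-directed causal curve from a point of $N$ to a point of $\Sigma$ has length at most that of $\gamma$. Then $\gamma'(0)$ is perpendicular to $T_{\gamma(0)}N$ and $\gamma'(l)$ is perpendicular to $T_{\gamma(l)}\Sigma$. -/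

import Mathlib

open Set
open scoped Manifold ContDiff ENNReal NNReal

noncomputable section

namespace Spacetime

section Metric

variable (n : ℕ) (L : Type*) [TopologicalSpace L] [ChartedSpace (EuclideanSpace ℝ (Fin n)) L]
  [IsManifold (𝓡 n) ∞ L]

/-- A smooth Lorentzian metric on the `n`-dimensional manifold `L`: a smooth field of symmetric
bilinear forms on the tangent spaces, each of signature `(-, +, …, +)`. The signature condition
says that there is a vector `v` with `g(v, v) < 0` whose orthogonal complement is positive
definite. -/
structure LorentzMetric where
  /-- The scalar product on each tangent space. -/
  inner (p : L) : TangentSpace (𝓡 n) p →L[ℝ] TangentSpace (𝓡 n) p →L[ℝ] ℝ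
  symm (p : L) (v w : TangentSpace (𝓡 n) p) : inner p v w = inner p w v
  signature (p : L) : ∃ v : TangentSpace (𝓡 n) p, inner p v v < 0 ∧
    ∀ w : TangentSpace (𝓡 n) p, w ≠ 0 → inner p v w = 0 → 0 < inner p w w
  contMDiff : ContMDiff (𝓡 n)
    ((𝓡 n).prod 𝓘(ℝ, EuclideanSpace ℝ (Fin n) →L[ℝ] EuclideanSpace ℝ (Fin n) →L[ℝ] ℝ)) ∞
    (fun p ↦ Bundle.TotalSpace.mk'
      (EuclideanSpace ℝ (Fin n) →L[ℝ] EuclideanSpace ℝ (Fin n) →L[ℝ] ℝ)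
      (E := fun p : L ↦ TangentSpace (𝓡 n) p →L[ℝ] TangentSpace (𝓡 n) p →L[ℝ] ℝ) p (inner p))

/-- A time-oriented Lorentzian structure on `L`: a Lorentzian metric together with a smooth
timelike vector field, which is declared to be future directed. -/
structure TimeOriented extends LorentzMetric n L where
  /-- The vector field that fixes the time orientation. -/
  future (p : L) : TangentSpace (𝓡 n) p
  future_timelike (p : L) : inner p (future p) (future p) < 0
  future_contMDiff : ContMDiff (𝓡 n) (𝓡 n).tangent ∞
    (fun p ↦ (⟨p, future p⟩ : TangentBundle (𝓡 n) L))

end Metric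

section Curves

variable {n : ℕ} {L : Type*} [TopologicalSpace L] [ChartedSpace (EuclideanSpace ℝ (Fin n)) L]
  [IsManifold (𝓡 n) ∞ L] (g : TimeOriented n L)

/-- Future-directed causal (that is, timelike or null) vectors. -/
def IsFutureCausal {p : L} (v : TangentSpace (𝓡 n) p) : Prop :=
  v ≠ 0 ∧ g.inner p v v ≤ 0 ∧ g.inner p (g.future p) v < 0

/-- Future-directed timelike vectors. -/
def IsFutureTimelike {p : L} (v : TangentSpace (𝓡 n) p) : Prop :=
  g.inner p v v < 0 ∧ g.inner p (g.future p) v < 0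

/-- The velocity at time `t` of a curve, seen as a curve with parameter domain `s`
(so it is one-sided at the end points if `s` is a closed interval). -/
def velocity (c : ℝ → L) (s : Set ℝ) (t : ℝ) : TangentSpace (𝓡 n) (c t) :=
  mfderivWithin 𝓘(ℝ, ℝ) (𝓡 n) c s t (1 : ℝ)

/-- `c : [a, b] → L` is a piecewise smooth future-directed causal curve: for some partition
`a = s 0 < s 1 < ⋯ < s m = b`, it is smooth with future-directed causal velocity on each closed
interval `[s i, s (i + 1)]`. (The values of `c` outside `[a, b]` play no role.) -/
def IsFutureCausalCurve (c : ℝ → L) (a b : ℝ) : Prop :=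
  a < b ∧ ∃ (m : ℕ) (s : ℕ → ℝ), s 0 = a ∧ s m = b ∧ ∀ i < m, s i < s (i + 1) ∧
    ContMDiffOn 𝓘(ℝ, ℝ) (𝓡 n) ∞ c (Icc (s i) (s (i + 1))) ∧
    ∀ t ∈ Icc (s i) (s (i + 1)), IsFutureCausal g (velocity c (Icc (s i) (s (i + 1))) t)

/-- The Lorentzian length `∫ₐᵇ √(-g(c', c')) dt` of a causal curve `c : [a, b] → L`. -/
def length (c : ℝ → L) (a b : ℝ) : ℝ :=
  ∫ t in a..b, √(-(g.inner (c t) (velocity c (Icc a b) t) (velocity c (Icc a b) t)))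

/-- The Lorentzian distance: the supremum of the lengths of the future-directed causal curves from
`p` to `q`; if there is no such curve, the supremum over the empty set in `[0, ∞]` is `0`. -/
def dist (p q : L) : ℝ≥0∞ :=
  ⨆ (c : ℝ → L) (a : ℝ) (b : ℝ) (_ : IsFutureCausalCurve g c a b ∧ c a = p ∧ c b = q),
    ENNReal.ofReal (length g c a b)

/-- The Lorentzian distance from a set: `d_N(q) = sup_{p ∈ N} d(p, q)`. -/
def distFrom (N : Set L) (q : L) : ℝ≥0∞ :=
  ⨆ p ∈ N, dist g p q

/-- The matrix of the metric in the chart `e`, as a bilinear form on `ℝⁿ` at the point `y` of the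
target of `e`. -/
def chartMetric (e : OpenPartialHomeomorph L (EuclideanSpace ℝ (Fin n)))
    (y v w : EuclideanSpace ℝ (Fin n)) : ℝ :=
  g.inner (e.symm y) (mfderiv (𝓡 n) (𝓡 n) e.symm y v) (mfderiv (𝓡 n) (𝓡 n) e.symm y w)

/-- The Christoffel symbols of the first kind of the Levi-Civita connection in the chart `e`:
`½ (∂_u g(v, w) + ∂_v g(u, w) - ∂_w g(u, v))` at `y`. -/
def christoffel (e : OpenPartialHomeomorph L (EuclideanSpace ℝ (Fin n)))
    (y u v w : EuclideanSpace ℝ (Fin n)) : ℝ :=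
  (fderiv ℝ (fun z ↦ chartMetric g e z v w) y u
    + fderiv ℝ (fun z ↦ chartMetric g e z u w) y v
    - fderiv ℝ (fun z ↦ chartMetric g e z u v) y w) / 2

/-- `c : [a, b] → L` is a geodesic: it is smooth and in every chart it satisfies the geodesic
equation `x'' + Γ(x', x') = 0`, written with lowered index as `g(x'', w) + Γ(x', x'; w) = 0` for
all `w ∈ ℝⁿ`. -/
def IsGeodesic (c : ℝ → L) (a b : ℝ) : Prop :=
  ContMDiffOn 𝓘(ℝ, ℝ) (𝓡 n) ∞ c (Icc a b) ∧
  ∀ e ∈ IsManifold.maximalAtlas (𝓡 n) ∞ L, ∀ t ∈ Icc a b, c t ∈ e.source →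
    ∀ w : EuclideanSpace ℝ (Fin n),
      chartMetric g e (e (c t)) (derivWithin (derivWithin (e ∘ c) (Icc a b)) (Icc a b) t) w
        + christoffel g e (e (c t)) (derivWithin (e ∘ c) (Icc a b) t)
            (derivWithin (e ∘ c) (Icc a b) t) w = 0

/-- The graph of the exponential map: `exp X = q` for the tangent vector `X` at `p`, that is,
the geodesic with initial velocity `X` is defined on `[0, 1]` and ends at `q`. -/
def IsExp (X : TangentBundle (𝓡 n) L) (q : L) : Prop :=
  ∃ c : ℝ → L, IsGeodesic g c 0 1 ∧
    (⟨c 0, velocity c (Icc 0 1) 0⟩ : TangentBundle (𝓡 n) L) = X ∧ c 1 = q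

end Curves

section Submanifolds

variable {n : ℕ} {L : Type*} [TopologicalSpace L] [ChartedSpace (EuclideanSpace ℝ (Fin n)) L]
  [IsManifold (𝓡 n) ∞ L] (g : TimeOriented n L)
  {k : ℕ} {N : Type*} [TopologicalSpace N] [ChartedSpace (EuclideanSpace ℝ (Fin k)) N]
  (ι : N → L)

/-- The tangent space `T_p N`, as a set of vectors of `T_p L`, of the submanifold `ι : N → L`:
the image of the differential of `ι` (it is empty if `p` does not lie on the submanifold). -/
def tangentTo (p : L) : Set (TangentSpace (𝓡 n) p) :=
  {v | ∃ (x : N) (w : TangentSpace (𝓡 k) x),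
    (⟨ι x, mfderiv (𝓡 k) (𝓡 n) ι x w⟩ : TangentBundle (𝓡 n) L) = ⟨p, v⟩}

/-- The vector `v ∈ T_p L` is perpendicular to the submanifold `ι : N → L` at its point `p`. -/
def IsPerp {p : L} (v : TangentSpace (𝓡 n) p) : Prop :=
  ∀ w ∈ tangentTo (k := k) ι p, g.inner p v w = 0

/-- The normal bundle of the submanifold `ι : N → L`, a subset of the tangent bundle of `L`. -/
def normalBundle : Set (TangentBundle (𝓡 n) L) :=
  {X | X.proj ∈ range ι ∧ IsPerp (k := k) g ι X.snd}

/-- `sup {t ≥ 0 : d_N(γ(t)) = t} ∈ [0, ∞]`, where `γ` is the inextensible geodesic with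
`γ(0) = p` and `γ'(0) = ν`, so that `γ(t) = exp (t ν)`; only those `t` count for which `γ(t)`
is defined. -/
def cutTime (p : L) (ν : TangentSpace (𝓡 n) p) : ℝ≥0∞ :=
  ⨆ (t : ℝ≥0) (_ : ∃ q : L, IsExp g (⟨p, (t : ℝ) • ν⟩ : TangentBundle (𝓡 n) L) q ∧
    distFrom g (range ι) q = (t : ℝ≥0∞)), (t : ℝ≥0∞)

/-- The set of the vectors `t ν`, where `ν` is a future-directed unit timelike normal vector of
the submanifold and `0 < t < s_N(ν)`, `s_N(ν)` being the number `cutTime`. -/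
def preDomain : Set (TangentBundle (𝓡 n) L) :=
  {X | ∃ (p : L) (ν : TangentSpace (𝓡 n) p) (t : ℝ), p ∈ range ι ∧ IsPerp (k := k) g ι ν ∧
    IsFutureTimelike g ν ∧ g.inner p ν ν = -1 ∧
    0 < t ∧ ENNReal.ofReal t < cutTime g ι p ν ∧ X = ⟨p, t • ν⟩}

/-- The set `𝓘⁺(N)`: the image under the normal exponential map of the interior of `preDomain`,
the interior being taken in the normal bundle. -/
def regularFuture : Set L :=
  {q | ∃ X : normalBundle (k := k) g ι,
    X ∈ interior ((↑) ⁻¹' preDomain (k := k) g ι : Set (normalBundle (k := k) g ι)) ∧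
    IsExp g (X : TangentBundle (𝓡 n) L) q}

end Submanifolds

section Longest

variable {n : ℕ} {L : Type*} [TopologicalSpace L] [ChartedSpace (EuclideanSpace ℝ (Fin n)) L]
  [IsManifold (𝓡 n) ∞ L] (g : TimeOriented n L)

/-- `c : [a, b] → L` is a longest curve from `A` to `B`: it joins `A` to `B` and no
future-directed causal curve from a point of `A` to a point of `B` is longer. -/
def IsLongest (A B : Set L) (c : ℝ → L) (a b : ℝ) : Prop :=
  c a ∈ A ∧ c b ∈ B ∧ ∀ (c' : ℝ → L) (a' b' : ℝ), IsFutureCausalCurve g c' a' b' →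
    c' a' ∈ A → c' b' ∈ B → length g c' a' b' ≤ length g c a b

end Longest

end Spacetime

end

set_option linter.unusedSectionVars false

namespace Spacetime

open Filter Topology MeasureTheory Interval

/-! ### Calculus of the length functional in an open set of a vector space. -/

section Analysis

/-! The proof is the first variation argument. Let `v` be tangent to the submanifold at an end point
of γ. In a chart around that end point, `v` is the velocity at 0 of a curve `h u` of displacements
that stay in the submanifold. Displace γ by `f t • h u`, where the cutoff `f` is 1 at the end point
and vanishes before γ leaves the chart and before the other end is reached. For small `u` the result
is again a future-directed timelike curve from one submanifold to the other, so the length has a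
local maximum at `u = 0` and its derivative there is zero.

Since γ is a geodesic, hence of constant speed `c`, the integrand of that derivative is the total
derivative of `-f ⟨γ', v⟩ / c`. Only boundary terms survive, and the one where `f = 0` drops out; so
`⟨γ', v⟩ = 0` at the end point.

The analytic core is `first_variation`; `longest_first_variation` carries it to the manifold, and
`isPerp_of_cutoff` treats both ends at once. -/

/-- Differentiation under the integral sign for a `C^1` integrand composed with a continuous path. -/
theorem hasFDerivAt_integral_comp_path {H P : Type*} [NormedAddCommGroup H] [NormedSpace ℝ H]
    [NormedAddCommGroup P] [NormedSpace ℝ P] {Ψ : H × P → ℝ} {W : Set (H × P)} (hW : IsOpen W)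
    (hΨ : ContDiffOn ℝ 1 Ψ W) {ξ : ℝ → P} {a b : ℝ} (hab : a ≤ b) (hξ : ContinuousOn ξ (Icc a b))
    {h₀ : H} (hmem : ∀ t ∈ Icc a b, (h₀, ξ t) ∈ W) :
    IntervalIntegrable (fun t ↦ (fderiv ℝ Ψ (h₀, ξ t)).comp (ContinuousLinearMap.inl ℝ H P))
      volume a b ∧
    HasFDerivAt (fun h ↦ ∫ t in a..b, Ψ (h, ξ t))
      (∫ t in a..b, (fderiv ℝ Ψ (h₀, ξ t)).comp (ContinuousLinearMap.inl ℝ H P)) h₀ := by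
  have hfd : ContinuousOn (fderiv ℝ Ψ) W := hΨ.continuousOn_fderiv_of_isOpen hW le_rfl
  have hpath (h : H) : ContinuousOn (fun t ↦ (h, ξ t)) (Icc a b) :=
    continuousOn_const.prodMk hξ
  have hK : IsCompact (ξ '' Icc a b) := isCompact_Icc.image_of_continuousOn hξ
  have hcont₀ : ContinuousOn (fun t ↦ ‖fderiv ℝ Ψ (h₀, ξ t)‖) (Icc a b) :=
    (hfd.comp (hpath h₀) hmem).norm
  obtain ⟨C, hC⟩ := (isCompact_Icc.image_of_continuousOn hcont₀).bddAbove
  -- `C` bounds the derivative along the compact path at `h₀`. The slack in `C + 1` makes the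
  -- condition open, so the tube lemma gives one neighbourhood of `h₀` on which the bound holds for
  -- every `t`: this is the dominating constant.
  have hW' : IsOpen (W ∩ (fun z ↦ ‖fderiv ℝ Ψ z‖) ⁻¹' Iio (C + 1)) :=
    hfd.norm.isOpen_inter_preimage hW isOpen_Iio
  obtain ⟨U, V, hU, -, hhU, hKV, hUV⟩ := generalized_tube_lemma (s := {h₀}) isCompact_singleton hK hW'
    (by
      rintro ⟨h, y⟩ ⟨hh, t, ht, rfl⟩
      obtain rfl : h = h₀ := hh
      exact ⟨hmem t ht, lt_of_le_of_lt (hC (mem_image_of_mem _ ht)) (lt_add_one C)⟩)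
  have hin {h : H} (hh : h ∈ U) {t : ℝ} (ht : t ∈ Icc a b) :
      (h, ξ t) ∈ W ∧ ‖fderiv ℝ Ψ (h, ξ t)‖ < C + 1 :=
    hUV (show (h, ξ t) ∈ U ×ˢ V from ⟨hh, hKV (mem_image_of_mem _ ht)⟩)
  have hIoc : Ι a b ⊆ Icc a b := by rw [uIoc_of_le hab]; exact Ioc_subset_Icc_self
  have huIcc : uIcc a b = Icc a b := uIcc_of_le hab
  have hcomp : Continuous fun A : H × P →L[ℝ] ℝ ↦ A.comp (ContinuousLinearMap.inl ℝ H P) := by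
    fun_prop
  have hF' : ContinuousOn (fun t ↦ (fderiv ℝ Ψ (h₀, ξ t)).comp (ContinuousLinearMap.inl ℝ H P))
      (Icc a b) := hcomp.comp_continuousOn (hfd.comp (hpath h₀) hmem)
  have hF {h : H} (hh : h ∈ U) : ContinuousOn (fun t ↦ Ψ (h, ξ t)) (Icc a b) :=
    hΨ.continuousOn.comp (hpath h) fun t ht ↦ (hin hh ht).1
  have hh₀ : h₀ ∈ U := hhU rfl
  refine ⟨hF'.intervalIntegrable_of_Icc hab, ?_⟩
  refine intervalIntegral.hasFDerivAt_integral_of_dominated_of_fderiv_le (μ := volume)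
    (F' := fun h t ↦ (fderiv ℝ Ψ (h, ξ t)).comp (ContinuousLinearMap.inl ℝ H P))
    (bound := fun _ ↦ (C + 1) * ‖ContinuousLinearMap.inl ℝ H P‖) (hU.mem_nhds hh₀) ?_ ((hF hh₀).intervalIntegrable_of_Icc hab)
    ?_ ?_ intervalIntegrable_const ?_
  · filter_upwards [hU.mem_nhds hh₀] with h hh
    exact (intervalIntegrable_iff.1 ((hF hh).intervalIntegrable_of_Icc hab)).aestronglyMeasurable
  · exact (intervalIntegrable_iff.1 (hF'.intervalIntegrable_of_Icc hab)).aestronglyMeasurable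
  · refine ae_of_all _ fun t ht h hh ↦ ?_
    exact (ContinuousLinearMap.opNorm_comp_le _ _).trans
      (mul_le_mul_of_nonneg_right (hin hh (hIoc ht)).2.le (norm_nonneg _))
  · refine ae_of_all _ fun t ht h hh ↦ ?_
    have h1 := ((hΨ.contDiffAt (hW.mem_nhds (hin hh (hIoc ht)).1)).differentiableAt
      one_ne_zero).hasFDerivAt
    exact HasFDerivAt.comp (f := fun h ↦ (h, ξ t)) h h1
      ((hasFDerivAt_id h).prodMk (hasFDerivAt_const _ _))

variable {E : Type*} [NormedAddCommGroup E] [NormedSpace ℝ E]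

/-- The quadratic form of the field of bilinear forms `B`, at the point `y + r h` and the vector
`z + s h`, as a function of `(h, y, z, r, s)`. -/
noncomputable def variedForm (B : E → E →L[ℝ] E →L[ℝ] ℝ) (q : E × E × E × ℝ × ℝ) : ℝ :=
  B (q.2.1 + q.2.2.2.1 • q.1) (q.2.2.1 + q.2.2.2.2 • q.1) (q.2.2.1 + q.2.2.2.2 • q.1)

theorem contDiffOn_variedForm {B : E → E →L[ℝ] E →L[ℝ] ℝ} {U : Set E} (hB : ContDiffOn ℝ ∞ B U) :
    ContDiffOn ℝ ∞ (variedForm B)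
      ((fun q : E × E × E × ℝ × ℝ ↦ q.2.1 + q.2.2.2.1 • q.1) ⁻¹' U) := by
  have h1 : ContDiff ℝ ∞ (fun q : E × E × E × ℝ × ℝ ↦ q.2.1 + q.2.2.2.1 • q.1) := by fun_prop
  have h2 : ContDiff ℝ ∞ (fun q : E × E × E × ℝ × ℝ ↦ q.2.2.1 + q.2.2.2.2 • q.1) := by fun_prop
  exact ((hB.comp h1.contDiffOn fun q hq ↦ hq).clm_apply h2.contDiffOn).clm_apply h2.contDiffOn

/-- The parameters for which the varied vector is timelike. -/
noncomputable def variedTimelike (B : E → E →L[ℝ] E →L[ℝ] ℝ) (U : Set E) : Set (E × E × E × ℝ × ℝ) :=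
  ((fun q : E × E × E × ℝ × ℝ ↦ q.2.1 + q.2.2.2.1 • q.1) ⁻¹' U) ∩ variedForm B ⁻¹' Iio 0

theorem isOpen_variedTimelike {B : E → E →L[ℝ] E →L[ℝ] ℝ} {U : Set E} (hU : IsOpen U)
    (hB : ContDiffOn ℝ ∞ B U) : IsOpen (variedTimelike B U) := by
  have h1 : Continuous (fun q : E × E × E × ℝ × ℝ ↦ q.2.1 + q.2.2.2.1 • q.1) := by fun_prop
  exact (contDiffOn_variedForm hB).continuousOn.isOpen_inter_preimage (hU.preimage h1) isOpen_Iio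

theorem contDiffOn_sqrt_variedForm {B : E → E →L[ℝ] E →L[ℝ] ℝ} {U : Set E}
    (hB : ContDiffOn ℝ ∞ B U) :
    ContDiffOn ℝ 1 (fun q ↦ √(-variedForm B q)) (variedTimelike B U) := by
  have h : ContDiffOn ℝ 1 (variedForm B) (variedTimelike B U) :=
    ((contDiffOn_variedForm hB).mono inter_subset_left).of_le (mod_cast le_top)
  exact h.neg.sqrt fun q hq ↦ (neg_pos.2 hq.2).ne'

/-- With `r = f t` and `s = f' t`, this is the integrand of the first variation of length. It is
computed along the line `u ↦ u • v`; symmetry of `B` merges the two terms in which a vector slot is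
differentiated. -/
theorem fderiv_sqrt_variedForm {B : E → E →L[ℝ] E →L[ℝ] ℝ} {U : Set E} (hU : IsOpen U)
    (hB : ContDiffOn ℝ ∞ B U) (hsymm : ∀ y ∈ U, ∀ v w, B y v w = B y w v) {y z : E} (hy : y ∈ U)
    (hz : B y z z < 0) (r s : ℝ) (v : E) :
    fderiv ℝ (fun q ↦ √(-variedForm B q)) (0, y, z, r, s) (v, 0) =
      -(r * fderiv ℝ B y v z z + 2 * s * B y z v) / (2 * √(-B y z z)) := by
  have hmem : ((0 : E), y, z, r, s) ∈ variedTimelike B U := by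
    simp [variedTimelike, variedForm, hy, hz]
  have hd := (((contDiffOn_sqrt_variedForm hB).contDiffAt
    ((isOpen_variedTimelike hU hB).mem_nhds hmem)).differentiableAt one_ne_zero).hasFDerivAt
  have hline : HasDerivAt (fun u : ℝ ↦ (u • v, y, z, r, s)) (v, 0) 0 := by
    have := ((hasDerivAt_id (0 : ℝ)).smul_const v).prodMk
      (hasDerivAt_const (0 : ℝ) (y, z, r, s))
    simpa using this
  have hd' := HasFDerivAt.comp_hasDerivAt_of_eq (f := fun u : ℝ ↦ (u • v, y, z, r, s)) 0 hd hline
    (by simp)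
  refine hd'.unique ?_
  have hp : HasDerivAt (fun u : ℝ ↦ y + r • u • v) (r • v) 0 := by
    simpa using (((hasDerivAt_id (0 : ℝ)).smul_const v).const_smul r).const_add y
  have hq : HasDerivAt (fun u : ℝ ↦ z + s • u • v) (s • v) 0 := by
    simpa using (((hasDerivAt_id (0 : ℝ)).smul_const v).const_smul s).const_add z
  have hBd : HasFDerivAt B (fderiv ℝ B y) y :=
    ((hB.contDiffAt (hU.mem_nhds hy)).differentiableAt (by simp)).hasFDerivAt
  have hBp := HasFDerivAt.comp_hasDerivAt_of_eq (E := E →L[ℝ] E →L[ℝ] ℝ)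
    (f := fun u : ℝ ↦ y + r • u • v) 0 hBd hp (by simp)
  have hall := ((hBp.clm_apply hq).clm_apply hq).neg.sqrt (by simpa using hz.ne)
  refine hall.congr_deriv ?_
  simp [hsymm y hy v z]
  ring

theorem hasDerivWithinAt_form {B : E → E →L[ℝ] E →L[ℝ] ℝ} {U : Set E} (hU : IsOpen U)
    (hB : ContDiffOn ℝ ∞ B U) {s : Set ℝ} {t : ℝ} {x y z : ℝ → E} {x' y' z' : E}
    (hx : HasDerivWithinAt x x' s t) (hy : HasDerivWithinAt y y' s t)
    (hz : HasDerivWithinAt z z' s t) (hmem : x t ∈ U) :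
    HasDerivWithinAt (fun t ↦ B (x t) (y t) (z t))
      (fderiv ℝ B (x t) x' (y t) (z t) + B (x t) y' (z t) + B (x t) (y t) z') s t := by
  have hBd : HasFDerivAt B (fderiv ℝ B (x t)) (x t) :=
    ((hB.contDiffAt (hU.mem_nhds hmem)).differentiableAt (by simp)).hasFDerivAt
  have hBx : HasDerivWithinAt (fun t ↦ B (x t)) (fderiv ℝ B (x t) x') s t :=
    HasFDerivAt.comp_hasDerivWithinAt (E := E →L[ℝ] E →L[ℝ] ℝ) t hBd hx
  exact ((hBx.clm_apply hy).clm_apply hz).congr_deriv rfl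

/-- Geodesics have constant speed. -/
theorem speed_const {B : E → E →L[ℝ] E →L[ℝ] ℝ} {U : Set E} (hU : IsOpen U)
    (hB : ContDiffOn ℝ ∞ B U) (hsymm : ∀ y ∈ U, ∀ v w, B y v w = B y w v)
    {a b : ℝ} {x x' x'' : ℝ → E}
    (hx : ∀ t ∈ Icc a b, HasDerivWithinAt x (x' t) (Icc a b) t)
    (hx' : ∀ t ∈ Icc a b, HasDerivWithinAt x' (x'' t) (Icc a b) t)
    (hmem : ∀ t ∈ Icc a b, x t ∈ U)
    (hgeo : ∀ t ∈ Icc a b, ∀ w, B (x t) (x'' t) w + (fderiv ℝ B (x t) (x' t) (x' t) w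
      + fderiv ℝ B (x t) (x' t) (x' t) w - fderiv ℝ B (x t) w (x' t) (x' t)) / 2 = 0) :
    ∀ t ∈ Icc a b, B (x t) (x' t) (x' t) = B (x a) (x' a) (x' a) := by
  have hder (t) (ht : t ∈ Icc a b) :
      HasDerivWithinAt (fun t ↦ B (x t) (x' t) (x' t)) 0 (Icc a b) t := by
    refine (hasDerivWithinAt_form hU hB (hx t ht) (hx' t ht) (hx' t ht) (hmem t ht)).congr_deriv ?_
    -- For `w = x'` two of the three Christoffel terms cancel, and twice the geodesic equation is
    -- the derivative of the speed.
    have h1 := hgeo t ht (x' t)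
    have h2 := hsymm _ (hmem t ht) (x' t) (x'' t)
    linarith
  exact constant_of_has_deriv_right_zero (fun t ht ↦ (hder t ht).continuousWithinAt)
    (fun t ht ↦ (hder t (Ico_subset_Icc_self ht)).mono_of_mem_nhdsWithin
      (Icc_mem_nhdsGE_of_mem ht))

/-- The first variation formula in a chart: if a geodesic of the metric `B` is at least as long as
the curves `x + f h(u)`, then the boundary terms of the first variation cancel. -/
theorem first_variation {B : E → E →L[ℝ] E →L[ℝ] ℝ} {U : Set E} (hU : IsOpen U)
    (hB : ContDiffOn ℝ ∞ B U) (hsymm : ∀ y ∈ U, ∀ v w, B y v w = B y w v)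
    {a b : ℝ} (hab : a < b) {x x' x'' : ℝ → E}
    (hx : ∀ t ∈ Icc a b, HasDerivWithinAt x (x' t) (Icc a b) t)
    (hx' : ∀ t ∈ Icc a b, HasDerivWithinAt x' (x'' t) (Icc a b) t)
    (hmem : ∀ t ∈ Icc a b, x t ∈ U) (htime : ∀ t ∈ Icc a b, B (x t) (x' t) (x' t) < 0)
    (hgeo : ∀ t ∈ Icc a b, ∀ w, B (x t) (x'' t) w + (fderiv ℝ B (x t) (x' t) (x' t) w
      + fderiv ℝ B (x t) (x' t) (x' t) w - fderiv ℝ B (x t) w (x' t) (x' t)) / 2 = 0)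
    {f f' : ℝ → ℝ} (hf : ∀ t, HasDerivAt f (f' t) t) (hf' : Continuous f')
    {h : ℝ → E} {v : E} (h0 : h 0 = 0) (hh : HasDerivAt h v 0)
    (hmax : ∀ᶠ u in 𝓝 (0 : ℝ),
      ∫ t in a..b, √(-B (x t + f t • h u) (x' t + f' t • h u) (x' t + f' t • h u)) ≤
        ∫ t in a..b, √(-B (x t) (x' t) (x' t))) :
    f b * B (x b) (x' b) v = f a * B (x a) (x' a) v := by
  set ξ : ℝ → E × E × ℝ × ℝ := fun t ↦ (x t, x' t, f t, f' t) with hξ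
  have hxc : ContinuousOn x (Icc a b) := fun t ht ↦ (hx t ht).continuousWithinAt
  have hx'c : ContinuousOn x' (Icc a b) := fun t ht ↦ (hx' t ht).continuousWithinAt
  have hfc : Continuous f := continuous_iff_continuousAt.2 fun t ↦ (hf t).continuousAt
  have hξc : ContinuousOn ξ (Icc a b) :=
    hxc.prodMk (hx'c.prodMk (hfc.continuousOn.prodMk hf'.continuousOn))
  have hspeed := speed_const hU hB hsymm hx hx' hmem hgeo
  set c : ℝ := √(-B (x a) (x' a) (x' a))
  have hc : 0 < c := Real.sqrt_pos.2 (neg_pos.2 (htime a (left_mem_Icc.2 hab.le)))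
  have hW (t) (ht : t ∈ Icc a b) : ((0 : E), ξ t) ∈ variedTimelike B U := by
    simp [variedTimelike, variedForm, hξ, hmem t ht, htime t ht]
  obtain ⟨hint, hΦ⟩ := hasFDerivAt_integral_comp_path (H := E)
    (P := E × E × ℝ × ℝ) (isOpen_variedTimelike hU hB)
    (contDiffOn_sqrt_variedForm hB) hab.le hξc hW
  have hcomp := HasFDerivAt.comp_hasDerivAt_of_eq (f := h) 0 hΦ hh h0.symm
  -- The length is differentiable as a function of the displacement vector in `E`, so `h` itself
  -- need only be differentiable at 0.
  have hloc : IsLocalMax ((fun k ↦ ∫ t in a..b, √(-variedForm B (k, ξ t))) ∘ h) 0 := by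
    filter_upwards [hmax] with u hu
    simpa [variedForm, hξ, h0] using hu
  have hzero := hloc.hasDerivAt_eq_zero hcomp
  rw [ContinuousLinearMap.intervalIntegral_apply hint v] at hzero
  -- Integration by parts in differential form: the geodesic equation tested against `v` turns the
  -- integrand into an exact derivative. Constancy of the speed allows the denominator to be the
  -- fixed number `c`.
  have hder (t) (ht : t ∈ Icc a b) :
      HasDerivWithinAt (fun t ↦ -(f t * B (x t) (x' t) v) / c)
        (((fderiv ℝ (fun q ↦ √(-variedForm B q)) (0, ξ t)).comp
          (ContinuousLinearMap.inl ℝ E (E × E × ℝ × ℝ))) v) (Icc a b) t := by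
    have h1 := (((hf t).hasDerivWithinAt (s := Icc a b)).mul (hasDerivWithinAt_form hU hB (hx t ht)
      (hx' t ht) (hasDerivWithinAt_const t _ v) (hmem t ht))).neg.div_const c
    refine h1.congr_deriv ?_
    simp only [ContinuousLinearMap.comp_apply, ContinuousLinearMap.inl_apply, hξ]
    symm
    refine (fderiv_sqrt_variedForm hU hB hsymm (hmem t ht) (htime t ht) (f t) (f' t) v).trans ?_
    rw [hspeed t ht]
    change _ / (2 * c) = _
    have h2 := hgeo t ht v
    simp only [map_zero]
    rw [div_eq_div_iff (by positivity) hc.ne']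
    linear_combination 2 * c * f t * h2
  have hftc := intervalIntegral.integral_eq_sub_of_hasDerivAt_of_le hab.le
    (fun t ht ↦ (hder t ht).continuousWithinAt)
    (fun t ht ↦ (hder t (Ioo_subset_Icc_self ht)).hasDerivAt (Icc_mem_nhds ht.1 ht.2))
    ((ContinuousLinearMap.apply ℝ ℝ v).integrable_comp hint.1 |> fun i ↦
      ⟨i, (ContinuousLinearMap.apply ℝ ℝ v).integrable_comp hint.2⟩)
  rw [hftc, ← sub_div, div_eq_zero_iff] at hzero
  rcases hzero with hz | hz
  · linarith
  · exact absurd hz hc.ne'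

end Analysis

/-! ### The metric, the time orientation and velocities in a chart. -/

section Chart

variable {n : ℕ} {L : Type*} [TopologicalSpace L] [ChartedSpace (EuclideanSpace ℝ (Fin n)) L]
  [IsManifold (𝓡 n) ∞ L] (g : TimeOriented n L)

/-- The metric in the chart `e`, as a field of continuous bilinear forms. -/
noncomputable def chartForm (e : OpenPartialHomeomorph L (EuclideanSpace ℝ (Fin n)))
    (y : EuclideanSpace ℝ (Fin n)) :
    EuclideanSpace ℝ (Fin n) →L[ℝ] EuclideanSpace ℝ (Fin n) →L[ℝ] ℝ :=
  ContinuousLinearMap.bilinearComp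
    (show EuclideanSpace ℝ (Fin n) →L[ℝ] EuclideanSpace ℝ (Fin n) →L[ℝ] ℝ from g.inner (e.symm y))
    (show EuclideanSpace ℝ (Fin n) →L[ℝ] EuclideanSpace ℝ (Fin n) from
      mfderiv (𝓡 n) (𝓡 n) e.symm y)
    (show EuclideanSpace ℝ (Fin n) →L[ℝ] EuclideanSpace ℝ (Fin n) from
      mfderiv (𝓡 n) (𝓡 n) e.symm y)

/-- The one-form dual to the time orientation in the chart `e`. -/
noncomputable def chartFuture (e : OpenPartialHomeomorph L (EuclideanSpace ℝ (Fin n)))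
    (y : EuclideanSpace ℝ (Fin n)) : EuclideanSpace ℝ (Fin n) →L[ℝ] ℝ :=
  (show EuclideanSpace ℝ (Fin n) →L[ℝ] ℝ from
    g.inner (e.symm y) (g.future (e.symm y))).comp
    (show EuclideanSpace ℝ (Fin n) →L[ℝ] EuclideanSpace ℝ (Fin n) from
      mfderiv (𝓡 n) (𝓡 n) e.symm y)

variable {g} {e : OpenPartialHomeomorph L (EuclideanSpace ℝ (Fin n))}

theorem chartForm_symm (y v w : EuclideanSpace ℝ (Fin n)) :
    chartForm g e y v w = chartForm g e y w v :=
  g.symm _ _ _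

/-- A coordinate vector field is the tangent map of `e.symm` after a constant section, hence smooth.
These fields are the arguments on which the metric is evaluated below. -/
theorem contMDiffOn_mfderiv_chart_symm (he : e ∈ IsManifold.maximalAtlas (𝓡 n) ∞ L)
    (v : EuclideanSpace ℝ (Fin n)) :
    ContMDiffOn (𝓡 n) (𝓡 n).tangent ∞
      (fun y ↦ (⟨e.symm y, mfderiv (𝓡 n) (𝓡 n) e.symm y v⟩ : TangentBundle (𝓡 n) L)) e.target := by
  have h1 := (contMDiffOn_symm_of_mem_maximalAtlas he).contMDiffOn_tangentMapWithin (m := ∞) le_rfl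
    e.open_target.uniqueMDiffOn
  have h2 : ContMDiff (𝓡 n) (𝓡 n).tangent ∞
      (fun y ↦ (⟨y, v⟩ : TangentBundle (𝓡 n) (EuclideanSpace ℝ (Fin n)))) :=
    contMDiff_vectorSpace_iff_contDiff.2 contDiff_const
  refine (h1.comp h2.contMDiffOn fun y hy ↦ hy).congr fun y hy ↦ ?_
  simp only [Function.comp, tangentMapWithin]
  rw [mfderivWithin_of_isOpen e.open_target hy]

theorem contDiffOn_chartForm (he : e ∈ IsManifold.maximalAtlas (𝓡 n) ∞ L) :
    ContDiffOn ℝ ∞ (chartForm g e) e.target := by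
  refine contDiffOn_clm_apply.2 fun v ↦ contDiffOn_clm_apply.2 fun w ↦ ?_
  rw [← contMDiffOn_iff_contDiffOn]
  -- The matrix entry is viewed as a section of the trivial line bundle over `L`, so that evaluation
  -- of bundle-valued bilinear maps applies; its fibre component is the smooth function wanted.
  have h : ContMDiffOn (𝓡 n) ((𝓡 n).prod 𝓘(ℝ, ℝ)) ∞
      (fun y ↦ (⟨e.symm y, chartForm g e y v w⟩ :
        Bundle.TotalSpace ℝ (Bundle.Trivial L ℝ))) e.target := by
    apply ContMDiffOn.clm_bundle_apply₂ (F₁ := EuclideanSpace ℝ (Fin n))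
      (F₂ := EuclideanSpace ℝ (Fin n)) (F₃ := ℝ) (E₃ := fun _ : L ↦ ℝ) (b := e.symm) (ψ := fun y ↦ g.inner (e.symm y))
      (v := fun y ↦ mfderiv (𝓡 n) (𝓡 n) e.symm y v) (w := fun y ↦ mfderiv (𝓡 n) (𝓡 n) e.symm y w)
    · exact g.contMDiff.comp_contMDiffOn (contMDiffOn_symm_of_mem_maximalAtlas he)
    · exact contMDiffOn_mfderiv_chart_symm he v
    · exact contMDiffOn_mfderiv_chart_symm he w
  intro y hy
  have := h y hy
  simp only [Bundle.contMDiffWithinAt_totalSpace] at this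
  exact this.2

theorem contDiffOn_chartFuture (he : e ∈ IsManifold.maximalAtlas (𝓡 n) ∞ L) :
    ContDiffOn ℝ ∞ (chartFuture g e) e.target := by
  refine contDiffOn_clm_apply.2 fun w ↦ ?_
  rw [← contMDiffOn_iff_contDiffOn]
  have h : ContMDiffOn (𝓡 n) ((𝓡 n).prod 𝓘(ℝ, ℝ)) ∞
      (fun y ↦ (⟨e.symm y, chartFuture g e y w⟩ :
        Bundle.TotalSpace ℝ (Bundle.Trivial L ℝ))) e.target := by
    apply ContMDiffOn.clm_bundle_apply₂ (F₁ := EuclideanSpace ℝ (Fin n))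
      (F₂ := EuclideanSpace ℝ (Fin n)) (F₃ := ℝ) (E₃ := fun _ : L ↦ ℝ) (b := e.symm) (ψ := fun y ↦ g.inner (e.symm y))
      (v := fun y ↦ g.future (e.symm y)) (w := fun y ↦ mfderiv (𝓡 n) (𝓡 n) e.symm y w)
    · exact g.contMDiff.comp_contMDiffOn (contMDiffOn_symm_of_mem_maximalAtlas he)
    · exact g.future_contMDiff.comp_contMDiffOn (contMDiffOn_symm_of_mem_maximalAtlas he)
    · exact contMDiffOn_mfderiv_chart_symm he w
  intro y hy
  have := h y hy
  simp only [Bundle.contMDiffWithinAt_totalSpace] at this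
  exact this.2

/-- Passes from derivatives of single matrix entries, as in `christoffel`, to the derivative of the
operator-valued `chartForm`, the form that `first_variation` takes. -/
theorem fderiv_chartMetric (he : e ∈ IsManifold.maximalAtlas (𝓡 n) ∞ L)
    {y : EuclideanSpace ℝ (Fin n)} (hy : y ∈ e.target) (u v w : EuclideanSpace ℝ (Fin n)) :
    fderiv ℝ (fun z ↦ chartMetric g e z v w) y u = fderiv ℝ (chartForm g e) y u v w := by
  have hd : HasFDerivAt (chartForm g e) (fderiv ℝ (chartForm g e) y) y :=
    (((contDiffOn_chartForm he).contDiffAt (e.open_target.mem_nhds hy)).differentiableAt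
      (by simp)).hasFDerivAt
  have h := (hd.clm_apply (hasFDerivAt_const v y)).clm_apply (hasFDerivAt_const w y)
  refine (congrArg (fun A : EuclideanSpace ℝ (Fin n) →L[ℝ] ℝ ↦ A u) h.fderiv).trans ?_
  simp

theorem christoffel_eq (he : e ∈ IsManifold.maximalAtlas (𝓡 n) ∞ L)
    {y : EuclideanSpace ℝ (Fin n)} (hy : y ∈ e.target) (u v w : EuclideanSpace ℝ (Fin n)) :
    christoffel g e y u v w = (fderiv ℝ (chartForm g e) y u v w + fderiv ℝ (chartForm g e) y v u w
      - fderiv ℝ (chartForm g e) y w u v) / 2 := by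
  simp only [christoffel, fderiv_chartMetric he hy]

/-- The velocity of a curve that is given in a chart. -/
theorem velocity_eq (he : e ∈ IsManifold.maximalAtlas (𝓡 n) ∞ L) {c : ℝ → L} {s : Set ℝ} {t : ℝ}
    (hs : UniqueDiffWithinAt ℝ s t) (ht : t ∈ s) {y : ℝ → EuclideanSpace ℝ (Fin n)}
    {y' : EuclideanSpace ℝ (Fin n)} (hy : HasDerivWithinAt y y' s t) (hmem : y t ∈ e.target)
    (hc : c =ᶠ[𝓝[s] t] e.symm ∘ y) :
    @Eq (EuclideanSpace ℝ (Fin n)) (velocity c s t) (mfderiv (𝓡 n) (𝓡 n) e.symm (y t) y') := by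
  have h1 : MDifferentiableAt (𝓡 n) (𝓡 n) e.symm (y t) :=
    ((contMDiffOn_symm_of_mem_maximalAtlas he).contMDiffAt
      (e.open_target.mem_nhds hmem)).mdifferentiableAt (by simp)
  have h2 : HasMFDerivWithinAt 𝓘(ℝ, ℝ) (𝓡 n) y s t (ContinuousLinearMap.toSpanSingleton ℝ y') :=
    hy.hasFDerivWithinAt.hasMFDerivWithinAt
  have h3 := (h1.hasMFDerivAt.comp_hasMFDerivWithinAt t h2).congr_of_eventuallyEq hc
    (hc.self_of_nhdsWithin ht)
  have h4 := h3.mfderivWithin hs.uniqueMDiffWithinAt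
  have h5 := congrArg (fun A : ℝ →L[ℝ] EuclideanSpace ℝ (Fin n) ↦ A 1) h4
  refine h5.trans ?_
  change (mfderiv (𝓡 n) (𝓡 n) e.symm (y t)) ((1 : ℝ) • y') = _
  rw [one_smul]

/-- All tangent spaces are by definition the model space, so the same vectors can be read at an
equal base point without transport. -/
theorem inner_congr {p q : L} (h : p = q) (v w : EuclideanSpace ℝ (Fin n)) :
    g.inner p v w = g.inner q v w := by
  subst h; rfl

theorem inner_future_congr {p q : L} (h : p = q) (w : EuclideanSpace ℝ (Fin n)) :
    g.inner p (g.future p) w = g.inner q (g.future q) w := by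
  subst h; rfl

theorem inner_velocity_eq (he : e ∈ IsManifold.maximalAtlas (𝓡 n) ∞ L) {c : ℝ → L} {s : Set ℝ}
    {t : ℝ} (hs : UniqueDiffWithinAt ℝ s t) (ht : t ∈ s) {y : ℝ → EuclideanSpace ℝ (Fin n)}
    {y' : EuclideanSpace ℝ (Fin n)} (hy : HasDerivWithinAt y y' s t) (hmem : y t ∈ e.target)
    (hc : c =ᶠ[𝓝[s] t] e.symm ∘ y) :
    g.inner (c t) (velocity c s t) (velocity c s t) = chartForm g e (y t) y' y' := by
  have h1 := velocity_eq he hs ht hy hmem hc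
  have h2 : c t = e.symm (y t) := hc.self_of_nhdsWithin ht
  refine (inner_congr h2 _ _).trans ?_
  rw [h1]; rfl

theorem inner_future_velocity_eq (he : e ∈ IsManifold.maximalAtlas (𝓡 n) ∞ L) {c : ℝ → L}
    {s : Set ℝ} {t : ℝ} (hs : UniqueDiffWithinAt ℝ s t) (ht : t ∈ s)
    {y : ℝ → EuclideanSpace ℝ (Fin n)}
    {y' : EuclideanSpace ℝ (Fin n)} (hy : HasDerivWithinAt y y' s t) (hmem : y t ∈ e.target)
    (hc : c =ᶠ[𝓝[s] t] e.symm ∘ y) :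
    g.inner (c t) (g.future (c t)) (velocity c s t) = chartFuture g e (y t) y' := by
  have h1 := velocity_eq he hs ht hy hmem hc
  have h2 : c t = e.symm (y t) := hc.self_of_nhdsWithin ht
  refine (inner_future_congr h2 _).trans ?_
  rw [h1]; rfl

theorem isFutureCausal_of_neg {p : L} {v : TangentSpace (𝓡 n) p} (h : g.inner p v v < 0)
    (h' : g.inner p (g.future p) v < 0) : IsFutureCausal g v := by
  refine ⟨?_, h.le, h'⟩
  rintro rfl
  simp at h

theorem eventuallyEq_chart {c : ℝ → L} {s : Set ℝ} {t : ℝ} (hc : ContinuousWithinAt c s t)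
    (hmem : c t ∈ e.source) : c =ᶠ[𝓝[s] t] e.symm ∘ (e ∘ c) := by
  filter_upwards [hc (e.open_source.mem_nhds hmem)] with r hr
  exact (e.left_inv hr).symm

theorem contDiffWithinAt_chart_comp (he : e ∈ IsManifold.maximalAtlas (𝓡 n) ∞ L) {c : ℝ → L}
    {s : Set ℝ} {t : ℝ} (hc : ContMDiffWithinAt 𝓘(ℝ, ℝ) (𝓡 n) ∞ c s t) (hmem : c t ∈ e.source) :
    ContDiffWithinAt ℝ ∞ (e ∘ c) s t :=
  (((contMDiffOn_of_mem_maximalAtlas he).contMDiffAt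
    (e.open_source.mem_nhds hmem)).comp_contMDiffWithinAt t hc).contDiffWithinAt

theorem contDiffWithinAt_derivWithin {F : Type*} [NormedAddCommGroup F] [NormedSpace ℝ F]
    {x : ℝ → F} {s : Set ℝ} (hs : UniqueDiffOn ℝ s) {t : ℝ}
    (hx : ContDiffWithinAt ℝ ∞ x s t) (ht : t ∈ s) : ContDiffWithinAt ℝ ∞ (derivWithin x s) s t :=
  (hx.fderivWithin_right (m := ∞) hs (mod_cast le_rfl) ht).clm_apply contDiffWithinAt_const

/-- Supplies the integrability needed to compare lengths over subintervals. -/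
theorem continuousOn_inner_velocity {c : ℝ → L} {a b : ℝ} (hab : a < b)
    (hc : ContMDiffOn 𝓘(ℝ, ℝ) (𝓡 n) ∞ c (Icc a b)) :
    ContinuousOn (fun t ↦ g.inner (c t) (velocity c (Icc a b) t) (velocity c (Icc a b) t))
      (Icc a b) := by
  intro t ht
  have hs := uniqueDiffOn_Icc hab
  set e := chartAt (EuclideanSpace ℝ (Fin n)) (c t)
  have he : e ∈ IsManifold.maximalAtlas (𝓡 n) ∞ L := IsManifold.chart_mem_maximalAtlas _
  have hsrc : c t ∈ e.source := mem_chart_source _ _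
  have hx := contDiffWithinAt_chart_comp he (hc t ht) hsrc
  have hx' := contDiffWithinAt_derivWithin hs hx ht
  have hB : ContinuousWithinAt (fun r ↦ chartForm g e ((e ∘ c) r)) (Icc a b) t :=
    ((contDiffOn_chartForm he).continuousOn.continuousAt (e.open_target.mem_nhds
      (e.map_source hsrc))).comp_continuousWithinAt (f := e ∘ c) hx.continuousWithinAt
  refine ((hB.clm_apply hx'.continuousWithinAt).clm_apply
    hx'.continuousWithinAt).congr_of_eventuallyEq_of_mem ?_ ht
  filter_upwards [(hc t ht).continuousWithinAt (e.open_source.mem_nhds hsrc), self_mem_nhdsWithin]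
    with r hr hr'
  exact inner_velocity_eq he (hs r hr') hr' ((contDiffWithinAt_chart_comp he (hc r hr')
    hr).differentiableWithinAt (by simp)).hasDerivWithinAt (e.map_source hr)
    (eventuallyEq_chart (hc r hr').continuousWithinAt hr)

end Chart

/-! ### The variation of a geodesic and its comparison with the longest curve. -/

section Variation

variable {n : ℕ} {L : Type*} [TopologicalSpace L] [ChartedSpace (EuclideanSpace ℝ (Fin n)) L]
  [IsManifold (𝓡 n) ∞ L] {g : TimeOriented n L}
  {e : OpenPartialHomeomorph L (EuclideanSpace ℝ (Fin n))}

open Classical in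
/-- The curve `γ`, displaced by `f t • k` in the chart `e`. -/
noncomputable def variedCurve (e : OpenPartialHomeomorph L (EuclideanSpace ℝ (Fin n))) (γ : ℝ → L) (f : ℝ → ℝ)
    (k : EuclideanSpace ℝ (Fin n)) (t : ℝ) : L :=
  if γ t ∈ e.source then e.symm (e (γ t) + f t • k) else γ t

/-- Both branches of the definition agree where the cutoff vanishes, so leaving the chart causes no
break in the curve. -/
theorem variedCurve_of_eq_zero {γ : ℝ → L} {f : ℝ → ℝ} {k : EuclideanSpace ℝ (Fin n)} {t : ℝ}
    (h : f t = 0) : variedCurve e γ f k t = γ t := by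
  unfold variedCurve
  split_ifs with hs
  · simp [h, e.left_inv hs]
  · rfl

theorem variedCurve_of_mem {γ : ℝ → L} {f : ℝ → ℝ} {k : EuclideanSpace ℝ (Fin n)} {t : ℝ}
    (h : γ t ∈ e.source) : variedCurve e γ f k t = e.symm (e (γ t) + f t • k) := if_pos h

theorem velocity_congr {c c' : ℝ → L} {s : Set ℝ} {t : ℝ} (h : c =ᶠ[𝓝[s] t] c') (ht : t ∈ s) :
    @Eq (EuclideanSpace ℝ (Fin n)) (velocity c s t) (velocity c' s t) :=
  congrArg (fun A : ℝ →L[ℝ] EuclideanSpace ℝ (Fin n) ↦ A 1)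
    (h.mfderivWithin_eq (I := 𝓘(ℝ, ℝ)) (I' := 𝓡 n) (h.self_of_nhdsWithin ht))

theorem inner_velocity_congr {c c' : ℝ → L} {s : Set ℝ} {t : ℝ} (h : c =ᶠ[𝓝[s] t] c')
    (ht : t ∈ s) : g.inner (c t) (velocity c s t) (velocity c s t) =
      g.inner (c' t) (velocity c' s t) (velocity c' s t) := by
  refine (inner_congr (h.self_of_nhdsWithin ht) _ _).trans ?_
  rw [velocity_congr h ht]

theorem inner_future_velocity_congr {c c' : ℝ → L} {s : Set ℝ} {t : ℝ} (h : c =ᶠ[𝓝[s] t] c')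
    (ht : t ∈ s) : g.inner (c t) (g.future (c t)) (velocity c s t) =
      g.inner (c' t) (g.future (c' t)) (velocity c' s t) := by
  refine (inner_future_congr (h.self_of_nhdsWithin ht) _).trans ?_
  rw [velocity_congr h ht]

/-- If two curves differ only over `[a, b]`, so do their lengths. -/
theorem integral_le_of_length_le {γ c : ℝ → L} {l a b : ℝ} (hl : 0 < l) (ha : 0 ≤ a) (hab : a < b)
    (hb : b ≤ l) (hγ : ContMDiffOn 𝓘(ℝ, ℝ) (𝓡 n) ∞ γ (Icc 0 l))
    (hc : ContMDiffOn 𝓘(ℝ, ℝ) (𝓡 n) ∞ c (Icc 0 l))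
    (heq : ∀ t ∈ Icc 0 l, t ∉ Icc a b → c =ᶠ[𝓝[Icc 0 l] t] γ)
    (hle : length g c 0 l ≤ length g γ 0 l) :
    ∫ t in a..b, √(-g.inner (c t) (velocity c (Icc 0 l) t) (velocity c (Icc 0 l) t)) ≤
      ∫ t in a..b, √(-g.inner (γ t) (velocity γ (Icc 0 l) t) (velocity γ (Icc 0 l) t)) := by
  have h1 : ContinuousOn (fun t ↦
      √(-g.inner (c t) (velocity c (Icc 0 l) t) (velocity c (Icc 0 l) t))) (Icc 0 l) :=
    (continuousOn_inner_velocity (g := g) hl hc).neg.sqrt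
  have h2 : ContinuousOn (fun t ↦
      √(-g.inner (γ t) (velocity γ (Icc 0 l) t) (velocity γ (Icc 0 l) t))) (Icc 0 l) :=
    (continuousOn_inner_velocity (g := g) hl hγ).neg.sqrt
  have hsub : Icc a b ⊆ Icc 0 l := Icc_subset_Icc ha hb
  -- The difference of the two integrands vanishes off `[a, b]`, so its integral over `[0, l]` is
  -- already its integral over `[a, b]`.
  have key := setIntegral_eq_of_subset_of_forall_sdiff_eq_zero (μ := volume)
    (f := fun t ↦ √(-g.inner (γ t) (velocity γ (Icc 0 l) t) (velocity γ (Icc 0 l) t))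
      - √(-g.inner (c t) (velocity c (Icc 0 l) t) (velocity c (Icc 0 l) t)))
    measurableSet_Icc hsub (fun t ht ↦ by
      have := inner_velocity_congr (g := g) (heq t ht.1 ht.2) ht.1
      simp only [this, sub_self])
  rw [integral_Icc_eq_integral_Ioc, integral_Icc_eq_integral_Ioc,
    ← intervalIntegral.integral_of_le hl.le, ← intervalIntegral.integral_of_le hab.le,
    intervalIntegral.integral_sub (h2.intervalIntegrable_of_Icc hl.le)
      (h1.intervalIntegrable_of_Icc hl.le),
    intervalIntegral.integral_sub ((h2.mono hsub).intervalIntegrable_of_Icc hab.le)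
      ((h1.mono hsub).intervalIntegrable_of_Icc hab.le)] at key
  unfold length at hle
  linarith

/-- The three conditions are open in the displacement, the position, the velocity and the cutoff
values, and the path traced by the latter is compact. This makes the varied curves admissible
competitors. -/
theorem eventually_chart_timelike (he : e ∈ IsManifold.maximalAtlas (𝓡 n) ∞ L) {a b : ℝ}
    {x x' : ℝ → EuclideanSpace ℝ (Fin n)} {f f' : ℝ → ℝ} (hx : ContinuousOn x (Icc a b))
    (hx' : ContinuousOn x' (Icc a b)) (hf : Continuous f) (hf' : Continuous f')
    (hmem : ∀ t ∈ Icc a b, x t ∈ e.target)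
    (htime : ∀ t ∈ Icc a b, chartForm g e (x t) (x' t) (x' t) < 0)
    (hfut : ∀ t ∈ Icc a b, chartFuture g e (x t) (x' t) < 0) :
    ∀ᶠ k in 𝓝 (0 : EuclideanSpace ℝ (Fin n)), ∀ t ∈ Icc a b, x t + f t • k ∈ e.target ∧
      chartForm g e (x t + f t • k) (x' t + f' t • k) (x' t + f' t • k) < 0 ∧
      chartFuture g e (x t + f t • k) (x' t + f' t • k) < 0 := by
  set ξ : ℝ → EuclideanSpace ℝ (Fin n) × EuclideanSpace ℝ (Fin n) × ℝ × ℝ :=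
    fun t ↦ (x t, x' t, f t, f' t) with hξ
  have hξc : ContinuousOn ξ (Icc a b) :=
    hx.prodMk (hx'.prodMk (hf.continuousOn.prodMk hf'.continuousOn))
  have hK := isCompact_Icc.image_of_continuousOn hξc
  have := hK.eventually_forall_of_forall_eventually (x₀ := (0 : EuclideanSpace ℝ (Fin n)))
    (P := fun k q ↦ q.1 + q.2.2.1 • k ∈ e.target ∧
      chartForm g e (q.1 + q.2.2.1 • k) (q.2.1 + q.2.2.2 • k) (q.2.1 + q.2.2.2 • k) < 0 ∧
      chartFuture g e (q.1 + q.2.2.1 • k) (q.2.1 + q.2.2.2 • k) < 0) (by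
    rintro _ ⟨t, ht, rfl⟩
    have c1 : Continuous fun q : EuclideanSpace ℝ (Fin n) × EuclideanSpace ℝ (Fin n) ×
      EuclideanSpace ℝ (Fin n) × ℝ × ℝ ↦ q.2.1 + q.2.2.2.1 • q.1 := by fun_prop
    have c2 : Continuous fun q : EuclideanSpace ℝ (Fin n) × EuclideanSpace ℝ (Fin n) ×
      EuclideanSpace ℝ (Fin n) × ℝ × ℝ ↦ q.2.2.1 + q.2.2.2.2 • q.1 := by fun_prop
    have m0 : e.target ∈ 𝓝 (x t) := e.open_target.mem_nhds (hmem t ht)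
    have d1 : ContinuousAt (chartForm g e) (x t) :=
      (contDiffOn_chartForm he).continuousOn.continuousAt m0
    have d2 : ContinuousAt (chartFuture g e) (x t) :=
      (contDiffOn_chartFuture he).continuousOn.continuousAt m0
    have v1 : x t + f t • (0 : EuclideanSpace ℝ (Fin n)) = x t := by simp
    have v2 : x' t + f' t • (0 : EuclideanSpace ℝ (Fin n)) = x' t := by simp
    have a1 := c1.continuousAt (x := ((0 : EuclideanSpace ℝ (Fin n)), ξ t))
    have a2 := c2.continuousAt (x := ((0 : EuclideanSpace ℝ (Fin n)), ξ t))
    have b1 := (d1.comp_of_eq a1 v1).clm_apply a2 |>.clm_apply a2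
    have b2 := (d2.comp_of_eq a1 v1).clm_apply a2
    refine (a1.eventually_mem (by simpa [hξ] using m0)).and
      ((b1.eventually_lt continuousAt_const ?_).and (b2.eventually_lt continuousAt_const ?_))
    · simpa [hξ] using htime t ht
    · simpa [hξ] using hfut t ht)
  filter_upwards [this] with k hk t ht
  exact hk _ (mem_image_of_mem ξ ht)

/-- The first variation formula for a longest timelike geodesic from `A` to `C`, displaced along
the end points of curves `k ↦ h k` in a chart. -/
theorem longest_first_variation {A C : Set L} {γ : ℝ → L} {l : ℝ} (hl : 0 < l)
    (hgeo : IsGeodesic g γ 0 l)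
    (htime : ∀ t ∈ Icc 0 l, IsFutureTimelike g (velocity γ (Icc 0 l) t))
    (hlong : IsLongest g A C γ 0 l) (he : e ∈ IsManifold.maximalAtlas (𝓡 n) ∞ L)
    {a b : ℝ} (ha : 0 ≤ a) (hab : a < b) (hb : b ≤ l) (hsrc : ∀ t ∈ Icc a b, γ t ∈ e.source)
    {f : ℝ → ℝ} (hf : ContDiff ℝ ∞ f) (hsupp : ∀ t ∈ Icc 0 l, t ∈ tsupport f → t ∈ Icc a b)
    {h : ℝ → EuclideanSpace ℝ (Fin n)} {v : EuclideanSpace ℝ (Fin n)} (h0 : h 0 = 0)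
    (hh : HasDerivAt h v 0) (hA : ∀ᶠ u in 𝓝 (0 : ℝ), variedCurve e γ f (h u) 0 ∈ A)
    (hC : ∀ᶠ u in 𝓝 (0 : ℝ), variedCurve e γ f (h u) l ∈ C) :
    f b * chartForm g e (e (γ b)) (derivWithin (e ∘ γ) (Icc 0 l) b) v =
      f a * chartForm g e (e (γ a)) (derivWithin (e ∘ γ) (Icc 0 l) a) v := by
  have hs := uniqueDiffOn_Icc hl
  have hsub : Icc a b ⊆ Icc 0 l := Icc_subset_Icc ha hb
  have hγ := hgeo.1
  have hf1 : ∀ t, HasDerivAt f (deriv f t) t := fun t ↦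
    (hf.differentiable (by simp) t).hasDerivAt
  have hf2 : Continuous (deriv f) := hf.continuous_deriv (by simp)
  have hxC (t) (ht : t ∈ Icc a b) : ContDiffWithinAt ℝ ∞ (e ∘ γ) (Icc 0 l) t :=
    contDiffWithinAt_chart_comp he (hγ t (hsub ht)) (hsrc t ht)
  have hxC' (t) (ht : t ∈ Icc a b) :
      ContDiffWithinAt ℝ ∞ (derivWithin (e ∘ γ) (Icc 0 l)) (Icc 0 l) t :=
    contDiffWithinAt_derivWithin hs (hxC t ht) (hsub ht)
  have hx (t) (ht : t ∈ Icc a b) :=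
    ((hxC t ht).differentiableWithinAt (by simp)).hasDerivWithinAt
  have hx' (t) (ht : t ∈ Icc a b) :=
    ((hxC' t ht).differentiableWithinAt (by simp)).hasDerivWithinAt
  have hmem (t) (ht : t ∈ Icc a b) : (e ∘ γ) t ∈ e.target := e.map_source (hsrc t ht)
  have hform (t) (ht : t ∈ Icc a b) := inner_velocity_eq (g := g) he (hs t (hsub ht)) (hsub ht)
    (hx t ht) (hmem t ht) (eventuallyEq_chart (hγ t (hsub ht)).continuousWithinAt (hsrc t ht))
  have hfut (t) (ht : t ∈ Icc a b) := inner_future_velocity_eq (g := g) he (hs t (hsub ht))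
    (hsub ht) (hx t ht) (hmem t ht)
    (eventuallyEq_chart (hγ t (hsub ht)).continuousWithinAt (hsrc t ht))
  have htube := eventually_chart_timelike (g := g) he
    (fun t ht ↦ (hxC t ht).continuousWithinAt.mono hsub)
    (fun t ht ↦ (hxC' t ht).continuousWithinAt.mono hsub) hf.continuous hf2 hmem
    (fun t ht ↦ (hform t ht) ▸ (htime t (hsub ht)).1)
    (fun t ht ↦ (hfut t ht) ▸ (htime t (hsub ht)).2)
  have hh' : Tendsto h (𝓝 0) (𝓝 0) := by simpa [h0] using hh.continuousAt.tendsto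
  refine first_variation e.open_target (contDiffOn_chartForm he)
    (fun y _ v w ↦ chartForm_symm y v w) hab (fun t ht ↦ (hx t ht).mono hsub)
    (fun t ht ↦ (hx' t ht).mono hsub) hmem (fun t ht ↦ (hform t ht) ▸ (htime t (hsub ht)).1)
    (fun t ht w ↦ ?_) hf1 hf2 h0 hh ?_
  · rw [← christoffel_eq he (hmem t ht)]
    exact hgeo.2 e he t (hsub ht) (hsrc t ht) w
  filter_upwards [hA, hC, hh'.eventually htube] with u huA huC hu
  set k := h u
  set c := variedCurve e γ f k with hc
  -- Off the topological support `f` vanishes near `t`, not merely at `t`, so the velocities agree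
  -- as well.
  have hout (t) (ht : t ∈ Icc 0 l) (ht' : t ∉ Icc a b) : c =ᶠ[𝓝[Icc 0 l] t] γ := by
    have : f =ᶠ[𝓝 t] 0 := notMem_tsupport_iff_eventuallyEq.1 fun hm ↦ ht' (hsupp t ht hm)
    filter_upwards [this.filter_mono nhdsWithin_le_nhds] with r hr
    exact variedCurve_of_eq_zero hr
  have hin (t) (ht : t ∈ Icc a b) :
      c =ᶠ[𝓝[Icc 0 l] t] e.symm ∘ fun r ↦ (e ∘ γ) r + f r • k := by
    filter_upwards [(hγ t (hsub ht)).continuousWithinAt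
      (e.open_source.mem_nhds (hsrc t ht))] with r hr
    exact variedCurve_of_mem hr
  have hder (t) (ht : t ∈ Icc a b) := (hx t ht).add ((hf1 t).hasDerivWithinAt.smul_const k)
  have hcform (t) (ht : t ∈ Icc a b) := inner_velocity_eq (g := g) he (hs t (hsub ht)) (hsub ht)
    (hder t ht) (hu t ht).1 (hin t ht)
  have hcfut (t) (ht : t ∈ Icc a b) := inner_future_velocity_eq (g := g) he (hs t (hsub ht))
    (hsub ht) (hder t ht) (hu t ht).1 (hin t ht)
  have hcs : ContMDiffOn 𝓘(ℝ, ℝ) (𝓡 n) ∞ c (Icc 0 l) := by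
    intro t ht
    by_cases ht' : t ∈ Icc a b
    · have h1 : ContDiffWithinAt ℝ ∞ (fun r ↦ (e ∘ γ) r + f r • k) (Icc 0 l) t :=
        (hxC t ht').add (hf.contDiffWithinAt.smul contDiffWithinAt_const)
      have h2 : ContMDiffAt (𝓡 n) (𝓡 n) ∞ e.symm ((fun r ↦ (e ∘ γ) r + f r • k) t) :=
        (contMDiffOn_symm_of_mem_maximalAtlas he).contMDiffAt
          (e.open_target.mem_nhds (hu t ht').1)
      exact (h2.comp_contMDiffWithinAt t h1.contMDiffWithinAt).congr_of_eventuallyEq_of_mem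
        (hin t ht') ht
    · exact (hγ t ht).congr_of_eventuallyEq_of_mem (hout t ht ht') ht
  have hcausal : IsFutureCausalCurve g c 0 l := by
    -- The varied curve is smooth on all of `[0, l]`: a partition with one piece suffices.
    refine ⟨hl, 1, fun i ↦ i * l, by simp, by simp, fun i hi ↦ ?_⟩
    obtain rfl : i = 0 := by omega
    simp only [Nat.cast_zero, zero_mul, zero_add, Nat.cast_one, one_mul]
    refine ⟨hl, hcs, fun t ht ↦ ?_⟩
    by_cases ht' : t ∈ Icc a b
    · exact isFutureCausal_of_neg ((hcform t ht').trans_lt (hu t ht').2.1)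
        ((hcfut t ht').trans_lt (hu t ht').2.2)
    · exact isFutureCausal_of_neg
        ((inner_velocity_congr (hout t ht ht') ht).trans_lt (htime t ht).1)
        ((inner_future_velocity_congr (hout t ht ht') ht).trans_lt (htime t ht).2)
  have hle := integral_le_of_length_le hl ha hab hb hγ hcs hout (hlong.2.2 c 0 l hcausal huA huC)
  have huIcc : uIcc a b = Icc a b := uIcc_of_le hab.le
  refine le_of_eq_of_le (intervalIntegral.integral_congr fun t ht ↦ ?_)
    (hle.trans_eq (intervalIntegral.integral_congr fun t ht ↦ ?_))
  · exact congrArg (fun r ↦ √(-r)) (hcform t (huIcc ▸ ht)).symm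
  · exact congrArg (fun r ↦ √(-r)) (hform t (huIcc ▸ ht))

end Variation

/-! ### Perpendicularity at the two ends. -/

section Perp

variable {n : ℕ} {L : Type*} [TopologicalSpace L] [ChartedSpace (EuclideanSpace ℝ (Fin n)) L]
  [IsManifold (𝓡 n) ∞ L] {g : TimeOriented n L}

/-- The tangent space at `p` is identified with the model space through the preferred chart at `p`,
so that chart has the identity as differential there, and so has its inverse. -/
theorem mfderiv_chartAt_symm_self (p : L) (v : EuclideanSpace ℝ (Fin n)) :
    @Eq (EuclideanSpace ℝ (Fin n)) (mfderiv (𝓡 n) (𝓡 n)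
      (chartAt (EuclideanSpace ℝ (Fin n)) p).symm (chartAt (EuclideanSpace ℝ (Fin n)) p p) v) v := by
  set e := chartAt (EuclideanSpace ℝ (Fin n)) p
  have he : e ∈ IsManifold.maximalAtlas (𝓡 n) ∞ L := IsManifold.chart_mem_maximalAtlas _
  have hsrc : p ∈ e.source := mem_chart_source _ _
  have h1 : MDifferentiableAt (𝓡 n) (𝓡 n) e p :=
    ((contMDiffOn_of_mem_maximalAtlas he).contMDiffAt
      (e.open_source.mem_nhds hsrc)).mdifferentiableAt (by simp)
  have h2 : MDifferentiableAt (𝓡 n) (𝓡 n) e.symm (e p) :=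
    ((contMDiffOn_symm_of_mem_maximalAtlas he).contMDiffAt
      (e.open_target.mem_nhds (e.map_source hsrc))).mdifferentiableAt (by simp)
  have h3 : HasMFDerivAt (𝓡 n) (𝓡 n) e p
      (ContinuousLinearMap.id ℝ (EuclideanSpace ℝ (Fin n))) := by
    refine ⟨h1.continuousAt, ?_⟩
    have heq : writtenInExtChartAt (𝓡 n) (𝓡 n) p e =ᶠ[𝓝 (extChartAt (𝓡 n) p p)] id := by
      have : e.target ∈ 𝓝 (e p) := e.open_target.mem_nhds (e.map_source hsrc)
      filter_upwards [show e.target ∈ 𝓝 (extChartAt (𝓡 n) p p) by simpa using this] with y hy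
      exact e.right_inv hy
    exact ((hasFDerivAt_id _).congr_of_eventuallyEq heq).hasFDerivWithinAt
  have h4 := (h2.hasMFDerivAt.comp p h3).congr_of_eventuallyEq (f₁ := id) (by
    filter_upwards [e.open_source.mem_nhds hsrc] with q hq using (e.left_inv hq).symm)
  have h5 := hasMFDerivAt_unique h4 (hasMFDerivAt_id p)
  exact congrArg (fun A : EuclideanSpace ℝ (Fin n) →L[ℝ] EuclideanSpace ℝ (Fin n) ↦ A v) h5

/-- A tangent vector of a submanifold is the velocity, in a chart, of a curve in it. -/
theorem exists_curve_of_tangent {k : ℕ} {N : Type*} [TopologicalSpace N]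
    [ChartedSpace (EuclideanSpace ℝ (Fin k)) N] [IsManifold (𝓡 k) ∞ N] {ι : N → L}
    (hι : ContMDiff (𝓡 k) (𝓡 n) ∞ ι) (x : N) (w : TangentSpace (𝓡 k) x) :
    ∃ h : ℝ → EuclideanSpace ℝ (Fin n), h 0 = 0 ∧
      HasDerivAt h (show EuclideanSpace ℝ (Fin n) from mfderiv (𝓡 k) (𝓡 n) ι x w) 0 ∧
      ∀ᶠ u in 𝓝 (0 : ℝ), (chartAt (EuclideanSpace ℝ (Fin n)) (ι x)).symm
        (chartAt (EuclideanSpace ℝ (Fin n)) (ι x) (ι x) + h u) ∈ range ι := by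
  set e := chartAt (EuclideanSpace ℝ (Fin n)) (ι x)
  set φ := chartAt (EuclideanSpace ℝ (Fin k)) x
  let w' : EuclideanSpace ℝ (Fin k) := w
  -- By definition `mfderiv` is the derivative of `ι` read in the preferred charts at `x` and `ι x`.
  have hd : HasFDerivAt (fun y ↦ e (ι (φ.symm y)))
      (show EuclideanSpace ℝ (Fin k) →L[ℝ] EuclideanSpace ℝ (Fin n) from
        mfderiv (𝓡 k) (𝓡 n) ι x) (φ x) := by
    have h : HasFDerivWithinAt (fun y ↦ e (ι (φ.symm y)))
        (show EuclideanSpace ℝ (Fin k) →L[ℝ] EuclideanSpace ℝ (Fin n) from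
          mfderiv (𝓡 k) (𝓡 n) ι x) (range (𝓡 k)) (φ x) :=
      ((hι.mdifferentiable (by simp)) x).hasMFDerivAt.2
    rwa [ModelWithCorners.range_eq_univ, hasFDerivWithinAt_univ] at h
  have hline : HasDerivAt (fun u : ℝ ↦ φ x + u • w') w' 0 := by
    simpa using ((hasDerivAt_id (0 : ℝ)).smul_const w').const_add (φ x)
  have hx : φ.symm (φ x) = x := φ.left_inv (mem_chart_source _ _)
  -- The curve is a straight line in the chart of the submanifold, pushed into the chart of `L` and
  -- recentred at 0. For small `u` it stays in `e.source`, where `e.symm` undoes `e`.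
  refine ⟨fun u ↦ e (ι (φ.symm (φ x + u • w'))) - e (ι x), by simp [hx], ?_, ?_⟩
  · exact (HasFDerivAt.comp_hasDerivAt_of_eq (f := fun u : ℝ ↦ φ x + u • w') 0 hd hline
      (by simp)).sub_const _
  · have hc : ContinuousAt (fun u : ℝ ↦ ι (φ.symm (φ x + u • w'))) 0 := by
      refine hι.continuous.continuousAt.comp ?_
      refine ContinuousAt.comp_of_eq (g := φ.symm) (y := φ x) ?_ hline.continuousAt (by simp)
      exact φ.continuousAt_symm (φ.map_source (mem_chart_source _ _))
    have hm : e.source ∈ 𝓝 (ι (φ.symm (φ x + (0 : ℝ) • w'))) := by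
      simpa [hx] using e.open_source.mem_nhds (mem_chart_source _ (ι x))
    filter_upwards [hc hm] with u hu
    exact ⟨φ.symm (φ x + u • w'), by rw [add_sub_cancel, e.left_inv hu]⟩

theorem isPerp_of_forall {k : ℕ} {N : Type*} [TopologicalSpace N]
    [ChartedSpace (EuclideanSpace ℝ (Fin k)) N] {ι : N → L} {p : L} (v : TangentSpace (𝓡 n) p)
    (h : ∀ (x : N) (w : TangentSpace (𝓡 k) x), ι x = p →
      g.inner p v (show EuclideanSpace ℝ (Fin n) from mfderiv (𝓡 k) (𝓡 n) ι x w) = 0) :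
    IsPerp (k := k) g ι v := by
  rintro u ⟨x, w, hxw⟩
  obtain rfl : ι x = p := congrArg Bundle.TotalSpace.proj hxw
  obtain rfl := eq_of_heq (Bundle.TotalSpace.mk.inj hxw).2
  exact h x w rfl

/-- Identifies the scalar product in `IsPerp` with the boundary term of the first variation; in the
preferred chart `v` is its own coordinate vector. -/
theorem inner_velocity_eq_chartForm {γ : ℝ → L} {l τ : ℝ} (hl : 0 < l)
    (hγ : ContMDiffOn 𝓘(ℝ, ℝ) (𝓡 n) ∞ γ (Icc 0 l)) (hτ : τ ∈ Icc 0 l)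
    (v : EuclideanSpace ℝ (Fin n)) :
    g.inner (γ τ) (velocity γ (Icc 0 l) τ) v =
      chartForm g (chartAt (EuclideanSpace ℝ (Fin n)) (γ τ))
        (chartAt (EuclideanSpace ℝ (Fin n)) (γ τ) (γ τ))
        (derivWithin (chartAt (EuclideanSpace ℝ (Fin n)) (γ τ) ∘ γ) (Icc 0 l) τ) v := by
  set e := chartAt (EuclideanSpace ℝ (Fin n)) (γ τ) with hedef
  have he : e ∈ IsManifold.maximalAtlas (𝓡 n) ∞ L := IsManifold.chart_mem_maximalAtlas _
  have hsrc : γ τ ∈ e.source := mem_chart_source _ _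
  have h1 := velocity_eq he (uniqueDiffOn_Icc hl τ hτ) hτ
    ((contDiffWithinAt_chart_comp he (hγ τ hτ) hsrc).differentiableWithinAt
      (by simp)).hasDerivWithinAt (e.map_source hsrc)
    (eventuallyEq_chart (hγ τ hτ).continuousWithinAt hsrc)
  have h2 := mfderiv_chartAt_symm_self (γ τ) v
  refine (inner_congr (e.left_inv hsrc).symm _ _).trans ?_
  rw [h1]
  exact congrArg (g.inner (e.symm (e (γ τ))) _) h2.symm

/-- The end point `γ τ` of a longest timelike geodesic, `f` being a cutoff function around `τ`. -/
theorem isPerp_of_cutoff {A C : Set L} {γ : ℝ → L} {l : ℝ} (hl : 0 < l)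
    (hgeo : IsGeodesic g γ 0 l)
    (htime : ∀ t ∈ Icc 0 l, IsFutureTimelike g (velocity γ (Icc 0 l) t))
    (hlong : IsLongest g A C γ 0 l) {k : ℕ} {N : Type*} [TopologicalSpace N]
    [ChartedSpace (EuclideanSpace ℝ (Fin k)) N] [IsManifold (𝓡 k) ∞ N] {ι : N → L}
    (hι : ContMDiff (𝓡 k) (𝓡 n) ∞ ι) {τ a b : ℝ} (hτ : τ ∈ Icc 0 l) (ha : 0 ≤ a) (hab : a < b)
    (hb : b ≤ l) (hsrc : ∀ t ∈ Icc a b, γ t ∈ (chartAt (EuclideanSpace ℝ (Fin n)) (γ τ)).source)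
    {f : ℝ → ℝ} (hf : ContDiff ℝ ∞ f) (hsupp : ∀ t ∈ Icc 0 l, t ∈ tsupport f → t ∈ Icc a b)
    (hfτ : f τ = 1) (hab' : a = τ ∧ f b = 0 ∨ b = τ ∧ f a = 0)
    (hA : f 0 = 0 ∨ τ = 0 ∧ A = range ι) (hC : f l = 0 ∨ τ = l ∧ C = range ι) :
    IsPerp (k := k) g ι (velocity γ (Icc 0 l) τ) := by
  refine isPerp_of_forall _ fun x w hx ↦ ?_
  set e := chartAt (EuclideanSpace ℝ (Fin n)) (γ τ) with hedef
  have he : e ∈ IsManifold.maximalAtlas (𝓡 n) ∞ L := IsManifold.chart_mem_maximalAtlas _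
  obtain ⟨h, h0, hh, hr⟩ := exists_curve_of_tangent hι x w
  rw [hx] at hr
  -- As `f τ = 1`, the end point undergoes the full displacement `h u` and so moves within the
  -- submanifold. The other end is fixed, because `f` vanishes there.
  have hτr : ∀ᶠ u in 𝓝 (0 : ℝ), variedCurve e γ f (h u) τ ∈ range ι := by
    filter_upwards [hr] with u hu
    rwa [variedCurve_of_mem (mem_chart_source _ _), hfτ, one_smul]
  have key := longest_first_variation hl hgeo htime hlong he ha hab hb hsrc hf hsupp h0 hh
    (by
      rcases hA with h1 | ⟨h1, h2⟩
      · simpa only [variedCurve_of_eq_zero h1] using Eventually.of_forall fun _ ↦ hlong.1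
      · rw [h2]; simpa only [h1] using hτr)
    (by
      rcases hC with h1 | ⟨h1, h2⟩
      · simpa only [variedCurve_of_eq_zero h1] using Eventually.of_forall fun _ ↦ hlong.2.1
      · rw [h2]; simpa only [h1] using hτr)
  rw [inner_velocity_eq_chartForm hl hgeo.1 hτ]
  rcases hab' with ⟨rfl, h1⟩ | ⟨rfl, h1⟩
  · rw [h1, hfτ, zero_mul, one_mul] at key
    exact key.symm
  · rw [h1, hfτ, zero_mul, one_mul] at key
    exact key

/-- A smooth cutoff function of width `δ` around `τ`. -/
theorem exists_cutoff (τ : ℝ) {δ : ℝ} (hδ : 0 < δ) : ∃ f : ℝ → ℝ, ContDiff ℝ ∞ f ∧ f τ = 1 ∧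
    (∀ t, δ ≤ |t - τ| → f t = 0) ∧ ∀ t ∈ tsupport f, |t - τ| ≤ δ := by
  let F : ContDiffBump τ := ⟨δ / 2, δ, by positivity, by linarith⟩
  refine ⟨F, F.contDiff, F.one_of_mem_closedBall (Metric.mem_closedBall_self (by positivity)),
    fun t ht ↦ F.zero_of_le_dist ht, fun t ht ↦ ?_⟩
  rw [F.tsupport_eq] at ht
  exact ht

theorem exists_Icc_chart {γ : ℝ → L} {l τ : ℝ} (hl : 0 < l)
    (hγ : ContMDiffOn 𝓘(ℝ, ℝ) (𝓡 n) ∞ γ (Icc 0 l)) (hτ : τ ∈ Icc 0 l) :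
    ∃ δ > 0, δ < l ∧ ∀ t ∈ Icc 0 l, |t - τ| ≤ δ →
      γ t ∈ (chartAt (EuclideanSpace ℝ (Fin n)) (γ τ)).source := by
  have h := (hγ τ hτ).continuousWithinAt ((chartAt (EuclideanSpace ℝ (Fin n))
    (γ τ)).open_source.mem_nhds (mem_chart_source _ _))
  obtain ⟨ε, hε, hball⟩ := Metric.mem_nhdsWithin_iff.1 h
  -- `ε / 2` puts the closed interval inside the open ball; `l / 2` gives `δ < l`, which keeps the
  -- cutoff away from the opposite end.
  refine ⟨min (ε / 2) (l / 2), by positivity, by linarith [min_le_right (ε / 2) (l / 2)],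
    fun t ht htτ ↦ hball ⟨?_, ht⟩⟩
  rw [Metric.mem_ball, Real.dist_eq]
  linarith [min_le_left (ε / 2) (l / 2)]

/-- A longest timelike geodesic is perpendicular to the submanifold from which it starts. -/
theorem IsLongest.isPerp_left {C : Set L} {γ : ℝ → L} {l : ℝ} (hl : 0 < l)
    (hgeo : IsGeodesic g γ 0 l)
    (htime : ∀ t ∈ Icc 0 l, IsFutureTimelike g (velocity γ (Icc 0 l) t)) {k : ℕ} {N : Type*}
    [TopologicalSpace N] [ChartedSpace (EuclideanSpace ℝ (Fin k)) N] [IsManifold (𝓡 k) ∞ N]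
    {ι : N → L} (hι : ContMDiff (𝓡 k) (𝓡 n) ∞ ι) (hlong : IsLongest g (range ι) C γ 0 l) :
    IsPerp (k := k) g ι (velocity γ (Icc 0 l) 0) := by
  have h0 := left_mem_Icc.2 hl.le
  obtain ⟨δ, hδ, hδl, hsrc⟩ := exists_Icc_chart hl hgeo.1 h0
  obtain ⟨f, hf, hf0, hfz, hfs⟩ := exists_cutoff 0 hδ
  refine isPerp_of_cutoff hl hgeo htime hlong hι h0 le_rfl hδ hδl.le (fun t ht ↦ ?_) hf
    (fun t ht ht' ↦ ?_) hf0 (.inl ⟨rfl, hfz _ ?_⟩) (.inr ⟨rfl, rfl⟩) (.inl (hfz _ ?_))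
  · exact hsrc t ⟨ht.1, ht.2.trans hδl.le⟩ (by rw [sub_zero, abs_of_nonneg ht.1]; exact ht.2)
  · exact ⟨ht.1, by simpa using (abs_le.1 (hfs t ht')).2⟩
  · rw [sub_zero]; exact le_abs_self _
  · rw [sub_zero]; exact hδl.le.trans (le_abs_self _)

/-- A longest timelike geodesic is perpendicular to the submanifold at which it ends. -/
theorem IsLongest.isPerp_right {A : Set L} {γ : ℝ → L} {l : ℝ} (hl : 0 < l)
    (hgeo : IsGeodesic g γ 0 l)
    (htime : ∀ t ∈ Icc 0 l, IsFutureTimelike g (velocity γ (Icc 0 l) t)) {k : ℕ} {N : Type*}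
    [TopologicalSpace N] [ChartedSpace (EuclideanSpace ℝ (Fin k)) N] [IsManifold (𝓡 k) ∞ N]
    {ι : N → L} (hι : ContMDiff (𝓡 k) (𝓡 n) ∞ ι) (hlong : IsLongest g A (range ι) γ 0 l) :
    IsPerp (k := k) g ι (velocity γ (Icc 0 l) l) := by
  have h0 := right_mem_Icc.2 hl.le
  obtain ⟨δ, hδ, hδl, hsrc⟩ := exists_Icc_chart hl hgeo.1 h0
  obtain ⟨f, hf, hf0, hfz, hfs⟩ := exists_cutoff l hδ
  -- The cutoff interval is now `[l - δ, l]`, so `f` vanishes both at its left end and at 0.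
  have hz (t : ℝ) (ht : t ≤ l - δ) : f t = 0 :=
    hfz t (by rw [abs_sub_comm]; exact (by linarith : δ ≤ l - t).trans (le_abs_self _))
  refine isPerp_of_cutoff (a := l - δ) hl hgeo htime hlong hι h0 (by linarith) (by linarith) le_rfl
    (fun t ht ↦ ?_) hf (fun t ht ht' ↦ ?_) hf0 (.inr ⟨rfl, hz _ le_rfl⟩)
    (.inl (hz _ (by linarith))) (.inr ⟨rfl, rfl⟩)
  · exact hsrc t ⟨by linarith [ht.1], ht.2⟩ (abs_le.2 ⟨by linarith [ht.1], by linarith [ht.2]⟩)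
  · exact ⟨by linarith [(abs_le.1 (hfs t ht')).1], ht.2⟩

end Perp

end Spacetime

theorem mainTheorem5 {n : ℕ} {L : Type*} [TopologicalSpace L] [T2Space L]
    [SecondCountableTopology L] [ChartedSpace (EuclideanSpace ℝ (Fin n)) L]
    [IsManifold (𝓡 n) ∞ L] (g : Spacetime.TimeOriented n L)
    {k : ℕ} {N : Type*} [TopologicalSpace N] [ChartedSpace (EuclideanSpace ℝ (Fin k)) N]
    [IsManifold (𝓡 k) ∞ N] (ι : N → L) (hι : Manifold.IsSmoothEmbedding (𝓡 k) (𝓡 n) ∞ ι)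
    {m : ℕ} {S : Type*} [TopologicalSpace S] [ChartedSpace (EuclideanSpace ℝ (Fin m)) S]
    [IsManifold (𝓡 m) ∞ S] (σ : S → L) (hσ : Manifold.IsSmoothEmbedding (𝓡 m) (𝓡 n) ∞ σ)
    (hfuture : range σ ⊆ Spacetime.regularFuture (k := k) g ι)
    (γ : ℝ → L) (l : ℝ) (hl : 0 < l)
    (hgeo : Spacetime.IsGeodesic g γ 0 l)
    (htime : ∀ t ∈ Icc 0 l, Spacetime.IsFutureTimelike g (Spacetime.velocity γ (Icc 0 l) t))
    (hlong : Spacetime.IsLongest g (range ι) (range σ) γ 0 l) :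
    Spacetime.IsPerp (k := k) g ι (Spacetime.velocity γ (Icc 0 l) 0) ∧
      Spacetime.IsPerp (k := m) g σ (Spacetime.velocity γ (Icc 0 l) l) := by
  exact ⟨hlong.isPerp_left hl hgeo htime hι.contMDiff,
    hlong.isPerp_right hl hgeo htime hσ.contMDiff⟩
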